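/- Let $M$ be a smooth $n$-dimensional manifold, and let $F:TM\to[0,\infty)$ be a Finsler structure on $M$: $F$ is smooth on the slit tangent bundle $N=TM\setminus\{0\}$, $F(x,\lambda y)=\lambda F(x,y)$ for all $\lambda>0$, and in natural coordinates the matrix $g_{ij}(x,y)=\frac12\,\frac{\partial^2F^2}{\partial y^i\partial y^j}(x,y)$ is positive definite on $N$. Write $\pi:N\to M$ for the projection and $I_x=\{y\in T_xM : F(x,y)=1\}$ for the indicatrix at $x$. In natural coordinates $(x,y)$ let $(g^{ij})=(g_{ij})^{-1}$, let $A_{ijk}=\frac F2\frac{\partial g_{ij}}{\partial y^k}$ be the Cartan tensor, $A^i_{jk}=g^{il}A_{ljk}$, $\gamma^i_{jk}=\frac12 g^{is}\left(\frac{\partial g_{sj}}{\partial x^k}-\frac{\partial g_{jk}}{\partial x^s}+\frac{\partial g_{sk}}{\partial x^j}\right)$, $N^i_j=\gamma^i_{jk}y^k-\frac1F A^i_{jk}\gamma^k_{rs}y^ry^s$, $\frac{\delta}{\delta x^j}=\frac{\partial}{\partial x^j}-N^i_j\frac{\partial}{\partial y^i}$. Let $\Gamma^i_{jk}=\frac12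 g^{is}\left(\frac{\delta g_{sj}}{\delta x^k}-\frac{\delta g_{jk}}{\delta x^s}+\frac{\delta g_{sk}}{\delta x^j}\right)$ be the coefficients of the Chern connection on $\pi^*TM$, with connection forms $\Gamma^i_{jk}\,dx^k$. The Berwald connection on $\pi^*TM$ is given by the connection forms ${}^b\omega^i_j=(\Gamma^i_{jk}+\dot A^i_{jk})\,dx^k$, where $\dot A^i_{kl}=-\frac{y^j}{F}P^i_{jkl}$ and $P^i_{jkl}=-F\,\frac{\partial\Gamma^i_{jk}}{\partial y^l}$. The structure $(M,F)$ is called Berwald if, in all natural coordinates, the coefficients $\Gamma^i_{jk}(x,y)$ of the Chern connection do not depend on $y$. Suppose that there is a smooth Riemannian metric $h$ on $M$, with Levi-Civita connection $\nabla^h$, whose parallel transport leaves the indicatrix of $F$ invariant: for every smooth curve $\gamma:[0,1]\to M$ the $\nabla^h$-parallel transport $\tau_\gamma:T_{\gamma(0)}M\to T_{\gamma(1)}M$ along $\gamma$ satisfies $\tau_\gamma(I_{\gamma(0)})=I_{\gamma(1)}$. Then the Berwald connection of $F$ is the pull-back connection $\pi^*\nabla^h$; that is, in all natural coordinates ${}^b\omega^i_j={}^h\Gamma^i_{jk}(x)\,dx^k$,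 where ${}^h\Gamma^i_{jk}$ are the Christoffel symbols of $h$. In particular its coefficients depend only on $x$. Moreover, $(M,F)$ is Berwald. -/

import Mathlib

open Set
open scoped Manifold ContDiff

noncomputable section

namespace FinslerGeometry

/-- The coordinate space `ℝⁿ`. -/
abbrev Coord (n : ℕ) := EuclideanSpace ℝ (Fin n)

/-- The partial derivative `∂f/∂xⁱ` of a function `f(x, y)`. -/
def dX {n : ℕ} (i : Fin n) (f : Coord n → Coord n → ℝ) (x y : Coord n) : ℝ :=
  fderiv ℝ (fun z => f z y) x (EuclideanSpace.single i 1)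

/-- The partial derivative `∂f/∂yⁱ` of a function `f(x, y)`. -/
def dY {n : ℕ} (i : Fin n) (f : Coord n → Coord n → ℝ) (x y : Coord n) : ℝ :=
  fderiv ℝ (fun z => f x z) y (EuclideanSpace.single i 1)

variable {n : ℕ} {M : Type*} [TopologicalSpace M] [ChartedSpace (Coord n) M]

/-! ### Natural coordinates on the tangent bundle -/

/-- The local coordinate systems of the smooth manifold `M`. -/
abbrev charts (n : ℕ) (M : Type*) [TopologicalSpace M] [ChartedSpace (Coord n) M] :
    Set (OpenPartialHomeomorph M (Coord n)) :=
  IsManifold.maximalAtlas (𝓡 n) ∞ M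

/-- The tangent vector `yⁱ ∂/∂xⁱ` at the point with coordinates `x` in the chart `e`. -/
def tangentOfCoord (e : OpenPartialHomeomorph M (Coord n)) (x y : Coord n) :
    TangentSpace (𝓡 n) (e.symm x) :=
  mfderiv (𝓡 n) (𝓡 n) e.symm x y

/-- The components of a tangent vector in the coordinate frame of the chart `e`. -/
def coordOfTangent (e : OpenPartialHomeomorph M (Coord n)) {p : M} (v : TangentSpace (𝓡 n) p) :
    Coord n :=
  mfderiv (𝓡 n) (𝓡 n) e p v

/-- The expression `F(x, y)` of a function on `TM` in the natural coordinates of `TM` induced by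
the chart `e` of `M`. -/
def localF (F : TangentBundle (𝓡 n) M → ℝ) (e : OpenPartialHomeomorph M (Coord n))
    (x y : Coord n) : ℝ :=
  F ⟨e.symm x, tangentOfCoord e x y⟩

/-! ### Finsler structures -/

/-- The components `g_{ij} = ½ ∂²F²/∂yⁱ∂yʲ` of the fundamental tensor. -/
def fundTensor (F : TangentBundle (𝓡 n) M → ℝ) (e : OpenPartialHomeomorph M (Coord n))
    (i j : Fin n) (x y : Coord n) : ℝ :=
  1 / 2 * dY i (dY j (fun x y => localF F e x y ^ 2)) x y

/-- The matrix `(g_{ij}(x, y))`. -/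
def fundMatrix (F : TangentBundle (𝓡 n) M → ℝ) (e : OpenPartialHomeomorph M (Coord n))
    (x y : Coord n) : Matrix (Fin n) (Fin n) ℝ :=
  Matrix.of fun i j => fundTensor F e i j x y

/-- A Finsler structure on `M`: a nonnegative function on `TM` that is smooth on the slit tangent
bundle, positively homogeneous of degree one in `y`, and strongly convex. -/
structure IsFinsler [IsManifold (𝓡 n) ∞ M] (F : TangentBundle (𝓡 n) M → ℝ) : Prop where
  nonneg : ∀ u, 0 ≤ F u
  smooth : ContMDiffOn (𝓡 n).tangent 𝓘(ℝ) ∞ F {u | u.2 ≠ 0}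
  homogeneous : ∀ (p : M) (v : TangentSpace (𝓡 n) p) (c : ℝ), 0 < c →
    F ⟨p, c • v⟩ = c * F ⟨p, v⟩
  strongly_convex : ∀ e ∈ charts n M, ∀ x ∈ e.target, ∀ y : Coord n, y ≠ 0 →
    (fundMatrix F e x y).PosDef

/-- The indicatrix `I_p = {v ∈ T_pM | F(p, v) = 1}`. -/
def indicatrix (F : TangentBundle (𝓡 n) M → ℝ) (p : M) : Set (TangentSpace (𝓡 n) p) :=
  {v | F ⟨p, v⟩ = 1}

/-! ### The non-linear connection, the Chern connection and the Berwald connection -/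

section Connections

variable (F : TangentBundle (𝓡 n) M → ℝ) (e : OpenPartialHomeomorph M (Coord n))

/-- The components `gⁱʲ` of the inverse of `(g_{ij})`. -/
def fundInv (i j : Fin n) (x y : Coord n) : ℝ :=
  (fundMatrix F e x y)⁻¹ i j

/-- The components `A_{ijk} = (F/2) ∂g_{ij}/∂yᵏ` of the Cartan tensor. -/
def cartan (i j k : Fin n) (x y : Coord n) : ℝ :=
  localF F e x y / 2 * dY k (fundTensor F e i j) x y

/-- `Aⁱ_{jk} = gⁱˡ A_{ljk}`. -/
def cartanUp (i j k : Fin n) (x y : Coord n) : ℝ :=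
  ∑ l, fundInv F e i l x y * cartan F e l j k x y

/-- The formal Christoffel symbols `γⁱ_{jk}` of the fundamental tensor. -/
def formalChristoffel (i j k : Fin n) (x y : Coord n) : ℝ :=
  1 / 2 * ∑ s, fundInv F e i s x y *
    (dX k (fundTensor F e s j) x y - dX s (fundTensor F e j k) x y + dX j (fundTensor F e s k) x y)

/-- The coefficients `Nⁱ_j` of the non-linear connection,
`Nⁱ_j / F = γⁱ_{jk} yᵏ/F - Aⁱ_{jk} γᵏ_{rs} (yʳ/F) (yˢ/F)`. -/
def nonlinearCoeff (i j : Fin n) (x y : Coord n) : ℝ :=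
  localF F e x y *
    (∑ k, formalChristoffel F e i j k x y * (y k / localF F e x y) -
      ∑ k, ∑ r, ∑ s, cartanUp F e i j k x y * formalChristoffel F e k r s x y *
        (y r / localF F e x y) * (y s / localF F e x y))

/-- The horizontal derivation `δ/δxʲ = ∂/∂xʲ - Nⁱ_j ∂/∂yⁱ`. -/
def deltaX (j : Fin n) (f : Coord n → Coord n → ℝ) (x y : Coord n) : ℝ :=
  dX j f x y - ∑ i, nonlinearCoeff F e i j x y * dY i f x y

/-- The coefficients `Γⁱ_{jk}` of the Chern connection, whose connection forms are
`ωⁱ_j = Γⁱ_{jk} dxᵏ`. -/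
def chernCoeff (i j k : Fin n) (x y : Coord n) : ℝ :=
  1 / 2 * ∑ s, fundInv F e i s x y *
    (deltaX F e k (fundTensor F e s j) x y - deltaX F e s (fundTensor F e j k) x y +
      deltaX F e j (fundTensor F e s k) x y)

/-- The hv-curvature `Pⁱ_{jkl} = -F ∂Γⁱ_{jk}/∂yˡ` of the Chern connection. -/
def hvCurvature (i j k l : Fin n) (x y : Coord n) : ℝ :=
  -localF F e x y * dY l (chernCoeff F e i j k) x y

/-- The Landsberg tensor `Ȧⁱ_{kl} = -(yʲ/F) Pⁱ_{jkl}`. -/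
def landsberg (i k l : Fin n) (x y : Coord n) : ℝ :=
  -∑ j, y j / localF F e x y * hvCurvature F e i j k l x y

/-- The coefficients `Γⁱ_{jk} + Ȧⁱ_{jk}` of the Berwald connection. -/
def berwaldCoeff (i j k : Fin n) (x y : Coord n) : ℝ :=
  chernCoeff F e i j k x y + landsberg F e i j k x y

/-- The connection forms of the Berwald connection on the bundle `π^*TM` over the slit tangent
bundle, `ᵇωⁱ_j = (Γⁱ_{jk} + Ȧⁱ_{jk}) dxᵏ`, at the point `(x, y)`, evaluated on the tangent vector
`ξ.1ᵏ ∂/∂xᵏ + ξ.2ᵏ ∂/∂yᵏ` of the slit tangent bundle. -/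
def berwaldForm (i j : Fin n) (x y : Coord n) (ξ : Coord n × Coord n) : ℝ :=
  ∑ k, berwaldCoeff F e i j k x y * ξ.1 k

end Connections

/-- `F` is of Berwald type: in all natural coordinates the coefficients of the Chern connection do
not depend on `y`. -/
def IsBerwald (F : TangentBundle (𝓡 n) M → ℝ) : Prop :=
  ∀ e ∈ charts n M, ∀ x ∈ e.target, ∀ y y' : Coord n, y ≠ 0 → y' ≠ 0 →
    ∀ i j k, chernCoeff F e i j k x y = chernCoeff F e i j k x y'

/-! ### Riemannian metrics, their Levi-Civita connection and parallel transport -/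

section Riemannian

variable [IsManifold (𝓡 n) ∞ M]

/-- Smooth Riemannian metrics on `M`. -/
abbrev RiemannianMetric (n : ℕ) (M : Type*) [TopologicalSpace M] [ChartedSpace (Coord n) M]
    [IsManifold (𝓡 n) ∞ M] :=
  Bundle.ContMDiffRiemannianMetric (𝓡 n) ∞ (Coord n) (TangentSpace (𝓡 n) : M → Type _)

variable (h : RiemannianMetric n M) (e : OpenPartialHomeomorph M (Coord n))

/-- The components `h_{ij}(x) = h(∂/∂xⁱ, ∂/∂xʲ)` of a Riemannian metric in the chart `e`. -/
def metricCoeff (i j : Fin n) (x : Coord n) : ℝ :=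
  h.inner (e.symm x) (tangentOfCoord e x (EuclideanSpace.single i 1))
    (tangentOfCoord e x (EuclideanSpace.single j 1))

/-- The components `hⁱʲ(x)` of the inverse metric. -/
def metricInv (i j : Fin n) (x : Coord n) : ℝ :=
  (Matrix.of fun a b => metricCoeff h e a b x)⁻¹ i j

/-- The coefficients `ʰΓⁱ_{jk} = ½ hⁱˢ (∂h_{sj}/∂xᵏ - ∂h_{jk}/∂xˢ + ∂h_{sk}/∂xʲ)` of the
Levi-Civita connection `∇ʰ`. -/
def leviCivitaCoeff (i j k : Fin n) (x : Coord n) : ℝ :=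
  1 / 2 * ∑ s, metricInv h e i s x *
    (fderiv ℝ (metricCoeff h e s j) x (EuclideanSpace.single k 1) -
      fderiv ℝ (metricCoeff h e j k) x (EuclideanSpace.single s 1) +
      fderiv ℝ (metricCoeff h e s k) x (EuclideanSpace.single j 1))

/-- The connection forms `π^*(ʰΓⁱ_{jk} dxᵏ)` of the pull-back connection `π^*∇ʰ` on the bundle
`π^*TM` over the slit tangent bundle, at the point `(x, y)`, evaluated on the tangent vector
`ξ.1ᵏ ∂/∂xᵏ + ξ.2ᵏ ∂/∂yᵏ` of the slit tangent bundle. -/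
def pullbackForm (i j : Fin n) (x _y : Coord n) (ξ : Coord n × Coord n) : ℝ :=
  ∑ k, leviCivitaCoeff h e i j k x * ξ.1 k

/-- `V` is a `∇ʰ`-parallel vector field along the curve `γ : [0, 1] → M`: at every time `t`,
`dVⁱ/dt + ʰΓⁱ_{jk}(γ) Vʲ dγᵏ/dt = 0` in a chart around `γ(t)` (the equation does not depend on the
chart). -/
def IsParallelAlong (γ : ℝ → M) (V : ∀ t, TangentSpace (𝓡 n) (γ t)) : Prop :=
  ∀ t ∈ Icc (0 : ℝ) 1, ∃ e ∈ charts n M, γ t ∈ e.source ∧ ∀ i,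
    HasDerivWithinAt (fun s => coordOfTangent e (V s) i)
      (-∑ j, ∑ k, leviCivitaCoeff h e i j k (e (γ t)) * coordOfTangent e (V t) j *
        derivWithin (fun s => e (γ s) k) (Icc 0 1) t)
      (Icc 0 1) t

/-- The image of a set of tangent vectors at `γ(0)` under the parallel transport of `∇ʰ` along
`γ : [0, 1] → M`. -/
def parallelTransportImage (γ : ℝ → M) (S : Set (TangentSpace (𝓡 n) (γ 0))) :
    Set (TangentSpace (𝓡 n) (γ 1)) :=
  {w | ∃ V : ∀ t, TangentSpace (𝓡 n) (γ t), IsParallelAlong h γ V ∧ V 0 ∈ S ∧ V 1 = w}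

/-- The parallel transport of `∇ʰ` leaves the indicatrix of `F` invariant: along every smooth curve
it maps the indicatrix at the initial point onto the indicatrix at the final point. -/
def LeavesIndicatrixInvariant (F : TangentBundle (𝓡 n) M → ℝ) : Prop :=
  ∀ γ : ℝ → M, ContMDiffOn 𝓘(ℝ) (𝓡 n) ∞ γ (Icc 0 1) →
    parallelTransportImage h γ (indicatrix F (γ 0)) = indicatrix F (γ 1)

end Riemannian

end FinslerGeometry

end

noncomputable section

namespace FinslerGeometry

/-! ### Calculus of the partial derivatives `∂/∂xⁱ` and `∂/∂yⁱ` -/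

section PartialDerivatives

variable {n : ℕ} {U : Set (Coord n × Coord n)} {f g : Coord n → Coord n → ℝ} {x y : Coord n}

/-! Since parallel transport is linear and `F` is positively homogeneous, invariance of the
indicatrix makes `F` constant along `∇ʰ`-parallel fields. Infinitesimally, `F²` is killed by the
horizontal vectors `∂/∂xᵏ - ʰΓⁱ_{jk} yʲ ∂/∂yⁱ` (`fderiv_localF_horizontal`, `dX_sqF`). The
coefficients of this first-order identity are linear in `y`, so two differentiations in `y` turn it
into a compatibility of `g` with `∇ʰ` (`dX_fundTensor`).

Were `Nⁱ_j` known to be `ʰΓⁱ_{lj} yˡ`, that compatibility would read `δg_{ab}/δxᵏ = ʰΓᵐ_{bk} g_{am}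
+ ʰΓᵐ_{ak} g_{bm}`, and since `ʰΓ` is symmetric the usual Koszul cancellation would give `Γ = ʰΓ`
(`christoffel_of_compatible`, `chernCoeff_eq`). The formula for `N` is the algebraic core
(`nonlinear_of_compatible`): the terms in `∂g/∂y` perturb `γ`, but `∂g/∂y` is totally symmetric and
annihilated by `y`, so only one of them survives contraction with `y`. The Cartan correction in the
definition of `N` cancels exactly that one.

The Chern coefficients thus depend on `x` alone, which is the Berwald property; then `P` and `Ȧ`
vanish and the Berwald coefficients are `ʰΓ` as well. -/

theorem dX_eq_fderiv (i : Fin n) (hf : DifferentiableAt ℝ (Function.uncurry f) (x, y)) :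
    dX i f x y = fderiv ℝ (Function.uncurry f) (x, y) (EuclideanSpace.single i 1, 0) := by
  have h := hf.hasFDerivAt.comp (f := fun z : Coord n => (z, y)) x
    ((hasFDerivAt_id x).prodMk (hasFDerivAt_const y x))
  have h' : HasFDerivAt (fun z => f z y) _ x := h
  rw [dX, h'.fderiv]
  rfl

theorem dY_eq_fderiv (i : Fin n) (hf : DifferentiableAt ℝ (Function.uncurry f) (x, y)) :
    dY i f x y = fderiv ℝ (Function.uncurry f) (x, y) (0, EuclideanSpace.single i 1) := by
  have h := hf.hasFDerivAt.comp (f := fun z : Coord n => (x, z)) y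
    ((hasFDerivAt_const x y).prodMk (hasFDerivAt_id y))
  have h' : HasFDerivAt (fun z => f x z) _ y := h
  rw [dY, h'.fderiv]
  rfl

/-- Openness of `U` keeps nearby points of the vertical line through `(x, y)` in `U`. The Finsler
identities hold only off the zero section, so this is the form in which they get differentiated. -/
theorem dY_congr (i : Fin n) (hU : IsOpen U) (hfg : ∀ x y, (x, y) ∈ U → f x y = g x y)
    (hp : (x, y) ∈ U) : dY i f x y = dY i g x y := by
  have hev : ∀ᶠ z in nhds y, (x, z) ∈ U :=
    (Continuous.prodMk_right x).continuousAt.preimage_mem_nhds (hU.mem_nhds hp)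
  have : (fun z => f x z) =ᶠ[nhds y] fun z => g x z := hev.mono fun z hz => hfg x z hz
  rw [dY, dY, this.fderiv_eq]

theorem differentiableAt_uncurry (hU : IsOpen U) (hf : ContDiffOn ℝ ∞ (Function.uncurry f) U)
    (hp : (x, y) ∈ U) : DifferentiableAt ℝ (Function.uncurry f) (x, y) :=
  (hf.contDiffAt (hU.mem_nhds hp)).differentiableAt (by simp)

theorem differentiableAt_snd (hU : IsOpen U) (hf : ContDiffOn ℝ ∞ (Function.uncurry f) U)
    (hp : (x, y) ∈ U) : DifferentiableAt ℝ (fun z => f x z) y :=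
  (differentiableAt_uncurry hU hf hp).comp (f := fun z : Coord n => (x, z)) y (by fun_prop)

theorem contDiffOn_fderiv_apply (hU : IsOpen U) (hf : ContDiffOn ℝ ∞ (Function.uncurry f) U)
    (v : Coord n × Coord n) :
    ContDiffOn ℝ ∞ (fun p => fderiv ℝ (Function.uncurry f) p v) U :=
  (hf.fderiv_of_isOpen hU (by simp)).clm_apply contDiffOn_const

theorem contDiffOn_dX (i : Fin n) (hU : IsOpen U) (hf : ContDiffOn ℝ ∞ (Function.uncurry f) U) :
    ContDiffOn ℝ ∞ (Function.uncurry (dX i f)) U :=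
  (contDiffOn_fderiv_apply hU hf (EuclideanSpace.single i 1, 0)).congr fun _ hp =>
    dX_eq_fderiv i (differentiableAt_uncurry hU hf hp)

theorem contDiffOn_dY (i : Fin n) (hU : IsOpen U) (hf : ContDiffOn ℝ ∞ (Function.uncurry f) U) :
    ContDiffOn ℝ ∞ (Function.uncurry (dY i f)) U :=
  (contDiffOn_fderiv_apply hU hf (0, EuclideanSpace.single i 1)).congr fun _ hp =>
    dY_eq_fderiv i (differentiableAt_uncurry hU hf hp)

theorem fderiv_fderiv_apply_comm {p : Coord n × Coord n} (hU : IsOpen U)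
    (hf : ContDiffOn ℝ ∞ (Function.uncurry f) U) (hp : p ∈ U) (v w : Coord n × Coord n) :
    fderiv ℝ (fun q => fderiv ℝ (Function.uncurry f) q v) p w =
      fderiv ℝ (fun q => fderiv ℝ (Function.uncurry f) q w) p v := by
  have hd : DifferentiableAt ℝ (fderiv ℝ (Function.uncurry f)) p :=
    ((hf.fderiv_of_isOpen hU (m := ∞) (by simp)).contDiffAt (hU.mem_nhds hp)).differentiableAt
      (by simp)
  have key : ∀ v w, fderiv ℝ (fun q => fderiv ℝ (Function.uncurry f) q v) p w =
      fderiv ℝ (fderiv ℝ (Function.uncurry f)) p w v := by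
    intro v w
    rw [fderiv_clm_apply hd (differentiableAt_const v)]
    simp
  rw [key, key]
  exact ((hf.contDiffAt (hU.mem_nhds hp)).isSymmSndFDerivAt (by
    simpa using WithTop.coe_le_coe.2 (le_top : (2 : ℕ∞) ≤ ⊤))).eq w v

theorem dX_dY_comm (i j : Fin n) (hU : IsOpen U) (hf : ContDiffOn ℝ ∞ (Function.uncurry f) U)
    (hp : (x, y) ∈ U) : dX i (dY j f) x y = dY j (dX i f) x y := by
  rw [dX_eq_fderiv i (differentiableAt_uncurry hU (contDiffOn_dY j hU hf) hp),
    dY_eq_fderiv j (differentiableAt_uncurry hU (contDiffOn_dX i hU hf) hp)]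
  have h₁ : Function.uncurry (dY j f) =ᶠ[nhds (x, y)]
      fun q => fderiv ℝ (Function.uncurry f) q (0, EuclideanSpace.single j 1) :=
    Filter.mem_of_superset (hU.mem_nhds hp) fun q hq =>
      dY_eq_fderiv j (differentiableAt_uncurry hU hf hq)
  have h₂ : Function.uncurry (dX i f) =ᶠ[nhds (x, y)]
      fun q => fderiv ℝ (Function.uncurry f) q (EuclideanSpace.single i 1, 0) :=
    Filter.mem_of_superset (hU.mem_nhds hp) fun q hq =>
      dX_eq_fderiv i (differentiableAt_uncurry hU hf hq)
  rw [h₁.fderiv_eq, h₂.fderiv_eq, fderiv_fderiv_apply_comm hU hf hp]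

theorem dY_dY_comm (i j : Fin n) (hU : IsOpen U) (hf : ContDiffOn ℝ ∞ (Function.uncurry f) U)
    (hp : (x, y) ∈ U) : dY i (dY j f) x y = dY j (dY i f) x y := by
  rw [dY_eq_fderiv i (differentiableAt_uncurry hU (contDiffOn_dY j hU hf) hp),
    dY_eq_fderiv j (differentiableAt_uncurry hU (contDiffOn_dY i hU hf) hp)]
  have h : ∀ j, Function.uncurry (dY j f) =ᶠ[nhds (x, y)]
      fun q => fderiv ℝ (Function.uncurry f) q (0, EuclideanSpace.single j 1) := fun j =>
    Filter.mem_of_superset (hU.mem_nhds hp) fun q hq =>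
      dY_eq_fderiv j (differentiableAt_uncurry hU hf hq)
  rw [(h i).fderiv_eq, (h j).fderiv_eq, fderiv_fderiv_apply_comm hU hf hp]

theorem fderiv_snd_apply (v : Coord n) :
    fderiv ℝ (fun z => f x z) y v = ∑ i, v i * dY i f x y := by
  conv_lhs => rw [← (EuclideanSpace.basisFun (Fin n) ℝ).sum_repr v]
  simp [dY]

theorem dX_const_mul (i : Fin n) (c : ℝ) (hU : IsOpen U)
    (hf : ContDiffOn ℝ ∞ (Function.uncurry f) U) (hp : (x, y) ∈ U) :
    dX i (fun x y => c * f x y) x y = c * dX i f x y := by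
  have hd : DifferentiableAt ℝ (fun z => f z y) x :=
    (differentiableAt_uncurry hU hf hp).comp (f := fun z : Coord n => (z, y)) x (by fun_prop)
  rw [dX, dX, fderiv_const_mul hd]
  simp

theorem dY_const_mul (i : Fin n) (c : ℝ) (hU : IsOpen U)
    (hf : ContDiffOn ℝ ∞ (Function.uncurry f) U) (hp : (x, y) ∈ U) :
    dY i (fun x y => c * f x y) x y = c * dY i f x y := by
  rw [dY, dY, fderiv_const_mul (differentiableAt_snd hU hf hp)]
  simp

theorem dY_add (i : Fin n) (hf : DifferentiableAt ℝ (fun z => f x z) y)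
    (hg : DifferentiableAt ℝ (fun z => g x z) y) :
    dY i (fun x y => f x y + g x y) x y = dY i f x y + dY i g x y := by
  rw [dY, dY, dY, fderiv_fun_add hf hg]
  simp

/-- The derivative of `∑ₛ cₛ(x) fₛ(x, y)`. -/
theorem dY_sum_mul {ι : Type*} [Fintype ι] (i : Fin n) {c : ι → Coord n → ℝ}
    {f : ι → Coord n → Coord n → ℝ} (hf : ∀ s, DifferentiableAt ℝ (fun z => f s x z) y) :
    dY i (fun x y => ∑ s, c s x * f s x y) x y = ∑ s, c s x * dY i (f s) x y := by
  simp only [dY]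
  rw [fderiv_fun_sum fun s _ => (hf s).const_mul _, _root_.sum_apply]
  refine Finset.sum_congr rfl fun s _ => ?_
  rw [fderiv_const_mul (hf s)]
  simp

/-- The derivative of `∑ₛ (∑ⱼ cₛⱼ(x) yʲ) fₛ(x, y)`. -/
theorem dY_sum_linear_mul {ι : Type*} [Fintype ι] (i : Fin n) {c : ι → Fin n → Coord n → ℝ}
    {f : ι → Coord n → Coord n → ℝ} (hf : ∀ s, DifferentiableAt ℝ (fun z => f s x z) y) :
    dY i (fun x y => ∑ s, (∑ j, c s j x * y j) * f s x y) x y =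
      ∑ s, (c s i x * f s x y + (∑ j, c s j x * y j) * dY i (f s) x y) := by
  have hl : ∀ s, HasFDerivAt (fun z : Coord n => ∑ j, c s j x * z j)
      (∑ j, c s j x • (EuclideanSpace.proj j : Coord n →L[ℝ] ℝ)) y := fun s =>
    HasFDerivAt.fun_sum fun j _ =>
      ((EuclideanSpace.proj j : Coord n →L[ℝ] ℝ).hasFDerivAt (x := y)).const_mul (c s j x)
  have h := HasFDerivAt.fun_sum (u := Finset.univ) fun s _ => (hl s).mul (hf s).hasFDerivAt
  have h' : HasFDerivAt (fun z : Coord n => ∑ s, (∑ j, c s j x * z j) * f s x z) _ y := h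
  simp only [dY]
  rw [h'.fderiv, _root_.sum_apply]
  refine Finset.sum_congr rfl fun s _ => ?_
  simp [Finset.sum_ite_eq', mul_comm, add_comm]

/-- The derivatives of a homogeneous function are homogeneous. -/
theorem dY_smul_of_homogeneous (i : Fin n) {m : ℕ} {c : ℝ} (hc : c ≠ 0)
    (hf : ∀ z, f x (c • z) = c ^ (m + 1) * f x z) (y : Coord n) :
    dY i f x (c • y) = c ^ m * dY i f x y := by
  -- The chain rule produces a factor `c`, which lowers the degree of homogeneity by one.
  have h₁ : fderiv ℝ (fun z => f x (c • z)) y = c • fderiv ℝ (fun z => f x z) (c • y) :=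
    fderiv_comp_smul (f := fun z => f x z) c
  have h₂ : fderiv ℝ (fun z => f x (c • z)) y = c ^ (m + 1) • fderiv ℝ (fun z => f x z) y := by
    simp only [hf]
    exact congrFun (fderiv_const_smul_field (f := fun z => f x z) (c ^ (m + 1))) y
  have h := DFunLike.congr_fun (h₁.symm.trans h₂) (EuclideanSpace.single i 1)
  simp only [_root_.smul_apply, smul_eq_mul] at h
  apply mul_left_cancel₀ hc
  simp only [dY]
  rw [h]
  ring

/-- Euler's identity. -/
theorem sum_mul_dY_of_homogeneous {m : ℕ} (hf : ∀ c : ℝ, 0 < c → f x (c • y) = c ^ m * f x y)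
    (hd : DifferentiableAt ℝ (fun z => f x z) y) :
    ∑ i, y i * dY i f x y = m * f x y := by
  rw [← fderiv_snd_apply]
  have h₁ : HasDerivAt (fun c : ℝ => f x (c • y)) (fderiv ℝ (fun z => f x z) y y) 1 := by
    have hl : HasDerivAt (fun c : ℝ => c • y) y 1 := by
      simpa using (hasDerivAt_id (1 : ℝ)).smul_const y
    have hd' : HasFDerivAt (fun z => f x z) (fderiv ℝ (fun z => f x z) y) ((1 : ℝ) • y) := by
      simpa using hd.hasFDerivAt
    exact hd'.comp_hasDerivAt (1 : ℝ) hl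
  have h₂ : HasDerivAt (fun c : ℝ => c ^ m * f x y) (m * f x y) 1 := by
    simpa using (hasDerivAt_pow m (1 : ℝ)).mul_const (f x y)
  refine h₁.unique (h₂.congr_of_eventuallyEq ?_)
  -- Homogeneity is available only for `c > 0`, which is a neighbourhood of `1`.
  filter_upwards [lt_mem_nhds (zero_lt_one' ℝ)] with c hc using hf c hc

end PartialDerivatives

/-! ### Smoothness of the coordinate expressions -/

section LocalExpressions

variable {n : ℕ} {M : Type*} [TopologicalSpace M] {e : OpenPartialHomeomorph M (Coord n)}

/-- The coordinate domain `{(x, y) | x ∈ e.target, y ≠ 0}` of the slit tangent bundle. -/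
def slit (e : OpenPartialHomeomorph M (Coord n)) : Set (Coord n × Coord n) :=
  e.target ×ˢ {0}ᶜ

theorem isOpen_slit : IsOpen (slit e) :=
  e.open_target.prod isOpen_compl_singleton

theorem mem_slit {x y : Coord n} (hx : x ∈ e.target) (hy : y ≠ 0) : (x, y) ∈ slit e :=
  ⟨hx, hy⟩

variable [ChartedSpace (Coord n) M]

theorem mdifferentiable_of_mem_charts (he : e ∈ charts n M) :
    e.MDifferentiable (𝓡 n) (𝓡 n) :=
  ⟨(contMDiffOn_of_mem_maximalAtlas he).mdifferentiableOn (by simp),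
    (contMDiffOn_symm_of_mem_maximalAtlas he).mdifferentiableOn (by simp)⟩

theorem coordOfTangent_tangentOfCoord (he : e ∈ charts n M) {x : Coord n} (hx : x ∈ e.target)
    (y : Coord n) : coordOfTangent e (tangentOfCoord e x y) = y :=
  DFunLike.congr_fun ((mdifferentiable_of_mem_charts he).comp_symm_deriv hx) y

theorem tangentOfCoord_ne_zero (he : e ∈ charts n M) {x y : Coord n} (hx : x ∈ e.target)
    (hy : y ≠ 0) : tangentOfCoord e x y ≠ 0 := by
  intro h
  have := coordOfTangent_tangentOfCoord he hx y
  rw [h] at this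
  apply hy
  rw [← this]
  exact map_zero (mfderiv (𝓡 n) (𝓡 n) e (e.symm x))

variable [IsManifold (𝓡 n) ∞ M] {F : TangentBundle (𝓡 n) M → ℝ}

theorem contMDiff_tangentBundle_mk :
    ContMDiff 𝓘(ℝ, Coord n × Coord n) (𝓡 n).tangent ∞
      (fun p : Coord n × Coord n => (⟨p.1, p.2⟩ : TangentBundle (𝓡 n) (Coord n))) := by
  intro p
  refine Bundle.contMDiffAt_totalSpace.2 ⟨contDiff_fst.contMDiff.contMDiffAt, ?_⟩
  refine contDiff_snd.contMDiff.contMDiffAt.congr_of_eventuallyEq (.of_forall fun q => ?_)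
  simp

theorem contMDiffOn_tangentOfCoord (he : e ∈ charts n M) :
    ContMDiffOn 𝓘(ℝ, Coord n × Coord n) (𝓡 n).tangent ∞
      (fun p : Coord n × Coord n =>
        (⟨e.symm p.1, tangentOfCoord e p.1 p.2⟩ : TangentBundle (𝓡 n) M))
      (e.target ×ˢ univ) := by
  have h₁ : ContMDiffOn (𝓡 n).tangent (𝓡 n).tangent ∞
      (tangentMapWithin (𝓡 n) (𝓡 n) e.symm e.target) _ :=
    (contMDiffOn_symm_of_mem_maximalAtlas he).contMDiffOn_tangentMapWithin (m := ∞) (by simp)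
      e.open_target.uniqueMDiffOn
  refine (h₁.comp (contMDiff_tangentBundle_mk.contMDiffOn (s := e.target ×ˢ univ))
    fun p hp => hp.1).congr fun p hp => ?_
  simp only [Function.comp, tangentMapWithin, tangentOfCoord]
  rw [mfderivWithin_of_isOpen e.open_target hp.1]

theorem contDiffOn_localF (hF : IsFinsler F) (he : e ∈ charts n M) :
    ContDiffOn ℝ ∞ (Function.uncurry (localF F e)) (slit e) := by
  rw [← contMDiffOn_iff_contDiffOn]
  exact hF.smooth.comp ((contMDiffOn_tangentOfCoord he).mono
    (prod_mono_right (subset_univ _))) fun p hp => tangentOfCoord_ne_zero he hp.1 hp.2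

theorem localF_smul (hF : IsFinsler F) (x y : Coord n) {c : ℝ} (hc : 0 < c) :
    localF F e x (c • y) = c * localF F e x y := by
  rw [localF, localF, ← hF.homogeneous _ _ c hc]
  congr 2
  exact map_smul (mfderiv (𝓡 n) (𝓡 n) e.symm x) c y

/-! ### Riemannian metrics -/

variable {h : RiemannianMetric n M}

theorem contDiffOn_metricCoeff (he : e ∈ charts n M) (i j : Fin n) :
    ContDiffOn ℝ ∞ (metricCoeff h e i j) e.target := by
  have hv : ∀ v : Coord n, ContMDiffOn (𝓡 n) (𝓡 n).tangent ∞
      (fun x => (⟨e.symm x, tangentOfCoord e x v⟩ : TangentBundle (𝓡 n) M)) e.target := fun v =>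
    (contMDiffOn_tangentOfCoord he).comp
      (contDiff_prodMk_left v).contMDiff.contMDiffOn
      fun x hx => ⟨hx, mem_univ _⟩
  have hh := h.contMDiff.comp_contMDiffOn (contMDiffOn_symm_of_mem_maximalAtlas he)
  have := ContMDiffOn.clm_bundle_apply₂ (F₁ := Coord n) (F₂ := Coord n) (F₃ := ℝ)
    (E₁ := (TangentSpace (𝓡 n) : M → Type _)) (E₂ := (TangentSpace (𝓡 n) : M → Type _))
    (E₃ := Bundle.Trivial M ℝ) (b := e.symm) (ψ := fun x => h.inner (e.symm x)) hh
    (hv (EuclideanSpace.single i 1)) (hv (EuclideanSpace.single j 1))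
  rw [← contMDiffOn_iff_contDiffOn]
  exact fun x hx => ((Bundle.contMDiffWithinAt_totalSpace).1 (this x hx)).2

theorem metricCoeff_symm (i j : Fin n) (x : Coord n) :
    metricCoeff h e i j x = metricCoeff h e j i x :=
  h.symm _ _ _

/-- A kernel vector of the matrix would be a nonzero tangent vector of zero `h`-length. -/
theorem det_metricCoeff_ne_zero (he : e ∈ charts n M) {x : Coord n} (hx : x ∈ e.target) :
    (Matrix.of fun a b => metricCoeff h e a b x).det ≠ 0 := by
  intro hdet
  obtain ⟨v, hv, hv0⟩ := Matrix.exists_mulVec_eq_zero_iff.2 hdet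
  have hne : WithLp.toLp 2 v ≠ (0 : Coord n) := by
    intro h0
    exact hv (by simpa using congrArg WithLp.ofLp h0)
  have hpos := h.pos _ _ (tangentOfCoord_ne_zero he hx hne)
  have hsum : tangentOfCoord e x (WithLp.toLp 2 v) =
      ∑ i, v i • tangentOfCoord e x (EuclideanSpace.single i 1) := by
    conv_lhs => rw [← (EuclideanSpace.basisFun (Fin n) ℝ).sum_repr (WithLp.toLp 2 v)]
    simp only [EuclideanSpace.basisFun_repr, EuclideanSpace.basisFun_apply, tangentOfCoord]
    exact (map_sum (mfderiv (𝓡 n) (𝓡 n) e.symm x) _ _).trans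
      (Finset.sum_congr rfl fun i _ => map_smul (mfderiv (𝓡 n) (𝓡 n) e.symm x) _ _)
  have : h.inner (e.symm x) (tangentOfCoord e x (WithLp.toLp 2 v))
      (tangentOfCoord e x (WithLp.toLp 2 v)) =
      ∑ i, v i * (Matrix.mulVec (Matrix.of fun a b => metricCoeff h e a b x) v) i := by
    rw [hsum]
    simp only [map_sum, map_smul, _root_.sum_apply, _root_.smul_apply, smul_eq_mul,
      Matrix.mulVec, dotProduct, metricCoeff, Finset.mul_sum, Matrix.of_apply]
    rw [Finset.sum_comm]
    exact Finset.sum_congr rfl fun i _ => Finset.sum_congr rfl fun j _ => by ring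
  rw [this, hv0] at hpos
  simp at hpos

theorem contDiffOn_matrix_det {m : Type*} [Fintype m] [DecidableEq m] {E : Type*}
    [NormedAddCommGroup E] [NormedSpace ℝ E] {s : Set E} {A : m → m → E → ℝ}
    (hA : ∀ a b, ContDiffOn ℝ ∞ (A a b) s) :
    ContDiffOn ℝ ∞ (fun x => (Matrix.of fun a b => A a b x).det) s := by
  simp only [Matrix.det_apply, Matrix.of_apply]
  exact ContDiffOn.sum fun σ _ => (contDiffOn_prod fun a _ => hA _ _).const_smul _

theorem contDiffOn_matrix_inv {m : Type*} [Fintype m] [DecidableEq m] {E : Type*}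
    [NormedAddCommGroup E] [NormedSpace ℝ E] {s : Set E} {A : m → m → E → ℝ}
    (hA : ∀ a b, ContDiffOn ℝ ∞ (A a b) s)
    (hdet : ∀ x ∈ s, (Matrix.of fun a b => A a b x).det ≠ 0) (i j : m) :
    ContDiffOn ℝ ∞ (fun x => (Matrix.of fun a b => A a b x)⁻¹ i j) s := by
  -- Cramer's rule: entries of the adjugate are determinants of the matrix with one row replaced by
  -- a basis vector, hence polynomial in the entries.
  simp only [Matrix.inv_def, Matrix.smul_apply, Ring.inverse_eq_inv', smul_eq_mul,
    Matrix.adjugate_apply]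
  refine ((contDiffOn_matrix_det hA).inv hdet).mul ?_
  refine (contDiffOn_matrix_det (A := fun a b x =>
    if a = j then (Pi.single i 1 : m → ℝ) b else A a b x) fun a b => ?_).congr fun x _ => ?_
  · split_ifs
    exacts [contDiffOn_const, hA a b]
  · congr 1
    ext a b
    simp [Matrix.updateRow_apply]

theorem contDiffOn_leviCivitaCoeff (he : e ∈ charts n M) (i j k : Fin n) :
    ContDiffOn ℝ ∞ (leviCivitaCoeff h e i j k) e.target := by
  have hd : ∀ a b c, ContDiffOn ℝ ∞
      (fun x => fderiv ℝ (metricCoeff h e a b) x (EuclideanSpace.single c 1)) e.target :=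
    fun a b c => ((contDiffOn_metricCoeff he a b).fderiv_of_isOpen e.open_target
      (by simp)).clm_apply contDiffOn_const
  have hi : ∀ a b, ContDiffOn ℝ ∞ (metricInv h e a b) e.target :=
    contDiffOn_matrix_inv (contDiffOn_metricCoeff he) fun x hx => det_metricCoeff_ne_zero he hx
  unfold leviCivitaCoeff
  exact contDiffOn_const.mul (ContDiffOn.sum fun s _ =>
    (hi i s).mul (((hd s j k).sub (hd j k s)).add (hd s k j)))

theorem leviCivitaCoeff_symm (i j k : Fin n) (x : Coord n) :
    leviCivitaCoeff h e i j k x = leviCivitaCoeff h e i k j x := by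
  have hjk : metricCoeff h e j k = metricCoeff h e k j := funext (metricCoeff_symm j k)
  simp only [leviCivitaCoeff, hjk]
  congr 1
  exact Finset.sum_congr rfl fun s _ => by ring

end LocalExpressions

/-! ### Homogeneity of the fundamental tensor and positivity of the Finsler function -/

section FundamentalTensor

variable {n : ℕ} {M : Type*} [TopologicalSpace M] [ChartedSpace (Coord n) M]
  [IsManifold (𝓡 n) ∞ M] {F : TangentBundle (𝓡 n) M → ℝ}
  {e : OpenPartialHomeomorph M (Coord n)}

/-- The square `F²(x, y)` of a Finsler function in natural coordinates. -/
def sqF {n : ℕ} {M : Type*} [TopologicalSpace M] [ChartedSpace (Coord n) M]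
    (F : TangentBundle (𝓡 n) M → ℝ) (e : OpenPartialHomeomorph M (Coord n)) (x y : Coord n) : ℝ :=
  localF F e x y ^ 2

theorem contDiffOn_sqF (hF : IsFinsler F) (he : e ∈ charts n M) :
    ContDiffOn ℝ ∞ (Function.uncurry (sqF F e)) (slit e) :=
  (contDiffOn_localF hF he).pow 2

theorem contDiffOn_fundTensor (hF : IsFinsler F) (he : e ∈ charts n M) (i j : Fin n) :
    ContDiffOn ℝ ∞ (Function.uncurry (fundTensor F e i j)) (slit e) :=
  contDiffOn_const.mul (contDiffOn_dY i isOpen_slit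
    (contDiffOn_dY j isOpen_slit (contDiffOn_sqF hF he)))

theorem sqF_smul (hF : IsFinsler F) (x : Coord n) {c : ℝ} (hc : 0 < c) (y : Coord n) :
    sqF F e x (c • y) = c ^ 2 * sqF F e x y := by
  rw [sqF, sqF, localF_smul hF x y hc, mul_pow]

theorem dY_sqF_smul (hF : IsFinsler F) (x : Coord n) {c : ℝ} (hc : 0 < c) (y : Coord n)
    (i : Fin n) : dY i (sqF F e) x (c • y) = c ^ 1 * dY i (sqF F e) x y :=
  dY_smul_of_homogeneous i hc.ne' (sqF_smul hF x hc) y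

theorem dY_dY_sqF_smul (hF : IsFinsler F) (x : Coord n) {c : ℝ} (hc : 0 < c) (y : Coord n)
    (i j : Fin n) :
    dY i (dY j (sqF F e)) x (c • y) = c ^ 0 * dY i (dY j (sqF F e)) x y :=
  dY_smul_of_homogeneous i hc.ne' (fun z => dY_sqF_smul hF x hc z j) y

/-- `g_{ij} yⁱ yʲ = F²`. -/
theorem sum_sum_fundTensor (hF : IsFinsler F) (he : e ∈ charts n M) {x y : Coord n}
    (hx : x ∈ e.target) (hy : y ≠ 0) :
    ∑ j, y j * ∑ i, y i * fundTensor F e i j x y = sqF F e x y := by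
  -- Euler's identity is used twice: for `∂F²/∂yʲ`, of degree one, then for `F²`, of degree two.
  have h₁ : ∀ j, ∑ i, y i * fundTensor F e i j x y = 1 / 2 * dY j (sqF F e) x y := by
    intro j
    have := sum_mul_dY_of_homogeneous (f := dY j (sqF F e)) (x := x) (y := y) (m := 1)
      (fun c hc => dY_sqF_smul hF x hc y j)
      (differentiableAt_snd isOpen_slit (contDiffOn_dY j isOpen_slit (contDiffOn_sqF hF he))
        (mem_slit hx hy))
    rw [Nat.cast_one, one_mul] at this
    rw [← this, Finset.mul_sum]
    exact Finset.sum_congr rfl fun i _ => by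
      change y i * (1 / 2 * dY i (dY j (sqF F e)) x y) = _
      ring
  have h₂ := sum_mul_dY_of_homogeneous (f := sqF F e) (x := x) (y := y) (m := 2)
    (fun c hc => sqF_smul hF x hc y)
    (differentiableAt_snd isOpen_slit (contDiffOn_sqF hF he) (mem_slit hx hy))
  calc ∑ j, y j * ∑ i, y i * fundTensor F e i j x y
      = 1 / 2 * ∑ j, y j * dY j (sqF F e) x y := by
        rw [Finset.mul_sum]
        exact Finset.sum_congr rfl fun j _ => by rw [h₁]; ring
    _ = sqF F e x y := by rw [h₂]; push_cast; ring

/-- Strong convexity at `y`, tested on `y` itself, makes `g_{ij} yⁱ yʲ = F²` positive. This permits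
division by `F` when normalising to the indicatrix and in the formula for `N`. -/
theorem localF_pos (hF : IsFinsler F) (he : e ∈ charts n M) {x y : Coord n}
    (hx : x ∈ e.target) (hy : y ≠ 0) : 0 < localF F e x y := by
  have hne : (WithLp.ofLp y : Fin n → ℝ) ≠ 0 := fun h => hy (by ext i; exact congrFun h i)
  have hpos := (hF.strongly_convex e he x hx y hy).dotProduct_mulVec_pos hne
  have hsq : 0 < sqF F e x y := by
    rw [← sum_sum_fundTensor hF he hx hy]
    refine hpos.trans_eq ?_
    simp only [dotProduct, Matrix.mulVec, fundMatrix, Matrix.of_apply, star_trivial,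
      Finset.mul_sum]
    rw [Finset.sum_comm]
    exact Finset.sum_congr rfl fun i _ => Finset.sum_congr rfl fun j _ => by ring
  exact (hF.nonneg _).lt_of_ne' fun h0 => hsq.ne' (by rw [sqF, localF, h0]; norm_num)

/-- `yᵏ ∂g_{ij}/∂yᵏ = 0`. -/
theorem sum_mul_dY_fundTensor (hF : IsFinsler F) (he : e ∈ charts n M) {x y : Coord n}
    (hx : x ∈ e.target) (hy : y ≠ 0) (i j : Fin n) :
    ∑ k, y k * dY k (fundTensor F e i j) x y = 0 := by
  have := sum_mul_dY_of_homogeneous (f := fundTensor F e i j) (x := x) (y := y) (m := 0)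
    (fun c hc => by
      change 1 / 2 * dY i (dY j (sqF F e)) x (c • y) = _ * (1 / 2 * dY i (dY j (sqF F e)) x y)
      rw [dY_dY_sqF_smul hF x hc]
      ring)
    (differentiableAt_snd isOpen_slit (contDiffOn_fundTensor hF he i j) (mem_slit hx hy))
  simpa using this

theorem fundTensor_symm (hF : IsFinsler F) (he : e ∈ charts n M) {x y : Coord n}
    (hp : (x, y) ∈ slit e) (i j : Fin n) : fundTensor F e i j x y = fundTensor F e j i x y :=
  congrArg (1 / 2 * ·) (dY_dY_comm i j isOpen_slit (contDiffOn_sqF hF he) hp)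

theorem dY_fundTensor_symm (hF : IsFinsler F) (he : e ∈ charts n M) {x y : Coord n}
    (hp : (x, y) ∈ slit e) (i j k : Fin n) :
    dY k (fundTensor F e i j) x y = dY k (fundTensor F e j i) x y :=
  dY_congr k isOpen_slit (fun _ _ hq => fundTensor_symm hF he hq i j) hp

/-- `∂g_{ij}/∂yᵏ` is half a third `y`-derivative of `F²`; with `dY_fundTensor_symm` this gives total
symmetry of the Cartan tensor. -/
theorem dY_fundTensor_comm (hF : IsFinsler F) (he : e ∈ charts n M) {x y : Coord n}
    (hp : (x, y) ∈ slit e) (i j k : Fin n) :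
    dY k (fundTensor F e i j) x y = dY i (fundTensor F e k j) x y := by
  have hj := contDiffOn_dY j isOpen_slit (contDiffOn_sqF hF he)
  have h : ∀ i k, dY k (fundTensor F e i j) x y = 1 / 2 * dY k (dY i (dY j (sqF F e))) x y :=
    fun i k => dY_const_mul k (1 / 2) isOpen_slit (contDiffOn_dY i isOpen_slit hj) hp
  rw [h, h, dY_dY_comm k i isOpen_slit hj hp]

theorem sum_fundInv_mul_fundTensor (hF : IsFinsler F) (he : e ∈ charts n M) {x y : Coord n}
    (hx : x ∈ e.target) (hy : y ≠ 0) (i m : Fin n) :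
    ∑ s, fundInv F e i s x y * fundTensor F e s m x y = if i = m then 1 else 0 := by
  have h := Matrix.nonsing_inv_mul (fundMatrix F e x y)
    (hF.strongly_convex e he x hx y hy).det_pos.ne'.isUnit
  have := congrFun (congrFun h i) m
  rwa [Matrix.mul_apply, Matrix.one_apply] at this

end FundamentalTensor

/-! ### Invariance of a Finsler function under parallel transport -/

section ParallelTransport

variable {n : ℕ} {M : Type*} [TopologicalSpace M] [ChartedSpace (Coord n) M]
  [IsManifold (𝓡 n) ∞ M] {F : TangentBundle (𝓡 n) M → ℝ} {h : RiemannianMetric n M}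
  {e : OpenPartialHomeomorph M (Coord n)}

/-- The velocity `-ʰΓⁱ_{jk}(x) yʲ vᵏ` of the components of a parallel vector field `y` along a curve
with velocity `v`. -/
def parallelVelocity (h : RiemannianMetric n M) (e : OpenPartialHomeomorph M (Coord n))
    (v x y : Coord n) : Coord n :=
  WithLp.toLp 2 fun i => -∑ j, ∑ k, leviCivitaCoeff h e i j k x * y j * v k

theorem contDiffAt_parallelVelocity (he : e ∈ charts n M) (v : Coord n) {x : Coord n}
    (hx : x ∈ e.target) (y : Coord n) :
    ContDiffAt ℝ ∞ (fun p : Coord n × Coord n => parallelVelocity h e v p.1 p.2) (x, y) := by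
  rw [contDiffAt_euclidean]
  intro i
  refine ContDiffAt.neg (ContDiffAt.sum fun j _ => ContDiffAt.sum fun k _ => ?_)
  refine ContDiffAt.mul (ContDiffAt.mul ?_ (by fun_prop)) contDiffAt_const
  exact ContDiffAt.comp (f := Prod.fst) (g := leviCivitaCoeff h e i j k) (x, y)
    ((contDiffOn_leviCivitaCoeff he i j k).contDiffAt (e.open_target.mem_nhds hx)) contDiffAt_fst

/-- Local existence of parallel vector fields along the coordinate line `t ↦ x + t v`. -/
theorem exists_parallel_along_line (he : e ∈ charts n M) (v : Coord n) {x : Coord n}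
    (hx : x ∈ e.target) (y : Coord n) :
    ∃ Y : ℝ → Coord n, Y 0 = y ∧ ∃ δ > 0, ∀ t ∈ Ioo (-δ) δ, x + t • v ∈ e.target ∧
      HasDerivAt Y (parallelVelocity h e v (x + t • v) (Y t)) t := by
  -- Adjoining the base point as an unknown with constant velocity `v` makes the transport equation
  -- autonomous, so Picard–Lindelöf applies to the pair.
  have hC : ContDiffAt ℝ 1
      (fun p : Coord n × Coord n => (v, parallelVelocity h e v p.1 p.2)) (x, y) :=
    contDiffAt_const.prodMk ((contDiffAt_parallelVelocity he v hx y).of_le (by simp))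
  obtain ⟨α, hα0, ε, hε, hα⟩ :=
    hC.exists_forall_mem_closedBall_exists_eq_forall_mem_Ioo_hasDerivAt₀ 0
  simp only [zero_sub, zero_add] at hα
  -- The first component minus `t • v` has zero derivative, so the base point does run along the
  -- line.
  have hfst : ∀ t ∈ Ioo (-ε) ε, HasDerivAt (fun t => (α t).1 - t • v) 0 t := by
    intro t ht
    have h₁ : HasDerivAt (fun t => (α t).1) v t := (hα t ht).fst
    exact (h₁.sub ((hasDerivAt_id t).smul_const v)).congr_deriv (by simp)
  have hline : ∀ t ∈ Ioo (-ε) ε, (α t).1 = x + t • v := by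
    intro t ht
    have := isOpen_Ioo.is_const_of_deriv_eq_zero isPreconnected_Ioo
      (fun t ht => (hfst t ht).differentiableAt.differentiableWithinAt)
      (fun t ht => (hfst t ht).deriv) ht (y := 0) ⟨by linarith, hε⟩
    rw [hα0] at this
    simp only [zero_smul, sub_zero] at this
    rw [← this, sub_add_cancel]
  have hev : ∀ᶠ t : ℝ in nhds 0, x + t • v ∈ e.target :=
    (show Continuous fun t : ℝ => x + t • v by fun_prop).continuousAt.preimage_mem_nhds
      (e.open_target.mem_nhds (by simpa using hx))
  obtain ⟨δ, hδ, hball⟩ := Metric.eventually_nhds_iff.1 hev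
  refine ⟨fun t => (α t).2, by simp [hα0], min δ ε, lt_min hδ hε, fun t ht => ?_⟩
  have htε : t ∈ Ioo (-ε) ε :=
    ⟨by linarith [ht.1, min_le_right δ ε], ht.2.trans_le (min_le_right _ _)⟩
  refine ⟨hball ?_, ?_⟩
  · rw [Real.dist_eq, sub_zero, abs_lt]
    exact ⟨by linarith [ht.1, min_le_left δ ε], ht.2.trans_le (min_le_left _ _)⟩
  · have : HasDerivAt (fun t => (α t).2) _ t := (hα t htε).snd
    rwa [hline t htε] at this

/-- A solution of the parallel transport equation in coordinates is a parallel vector field. -/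
theorem isParallelAlong_line (he : e ∈ charts n M) {v x : Coord n} {Y : ℝ → Coord n}
    {s c : ℝ} (hY : ∀ t ∈ Icc (0 : ℝ) 1, x + (t * s) • v ∈ e.target ∧
      HasDerivAt Y (parallelVelocity h e v (x + (t * s) • v) (Y (t * s))) (t * s)) :
    IsParallelAlong h (fun t => e.symm (x + (t * s) • v))
      (fun t => tangentOfCoord e (x + (t * s) • v) (c • Y (t * s))) := by
  intro t ht
  refine ⟨e, he, e.map_target (hY t ht).1, fun i => ?_⟩
  have hγ : ∀ k, derivWithin (fun r => e (e.symm (x + (r * s) • v)) k) (Icc 0 1) t =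
      s * v k := by
    intro k
    have h₁ : HasDerivAt (fun r : ℝ => x k + (r * s) * v k) (s * v k) t := by
      simpa using (((hasDerivAt_id t).mul_const s).mul_const (v k)).const_add (x k)
    refine HasDerivWithinAt.derivWithin (h₁.hasDerivWithinAt.congr_of_mem (fun r hr => ?_) ht)
      (uniqueDiffOn_Icc zero_lt_one t ht)
    rw [e.right_inv (hY r hr).1]
    simp
  simp only [hγ, e.right_inv (hY t ht).1, coordOfTangent_tangentOfCoord he (hY t ht).1]
  have h₂ : HasDerivAt (fun r => c * Y (r * s) i)
      (c * (parallelVelocity h e v (x + (t * s) • v) (Y (t * s)) i * s)) t := by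
    have h₃ := ((EuclideanSpace.proj i : Coord n →L[ℝ] ℝ).hasFDerivAt.comp_hasDerivAt _ (hY t ht).2)
    have h₄ : HasDerivAt (fun r : ℝ => r * s) s t := by
      simpa using (hasDerivAt_id t).mul_const s
    exact (HasDerivAt.comp t h₃ h₄).const_mul c
  refine (h₂.hasDerivWithinAt.congr_of_mem (s := Icc 0 1) (fun r hr => ?_) ht).congr_deriv ?_
  · rw [coordOfTangent_tangentOfCoord he (hY r hr).1]
    simp
  -- The transport equation is linear in the field and in the velocity, so `c` and the
  -- reparametrisation factor `s` pass through both sides.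
  · simp only [parallelVelocity, neg_mul, mul_neg, Finset.sum_mul, Finset.mul_sum, PiLp.smul_apply,
      smul_eq_mul]
    exact congrArg Neg.neg (Finset.sum_congr rfl fun j _ => Finset.sum_congr rfl fun k _ => by ring)

/-- If parallel transport preserves the indicatrix, then `F` is constant along parallel vector
fields; infinitesimally, `F` is annihilated by the horizontal vectors of `∇ʰ`. -/
theorem fderiv_localF_horizontal (hF : IsFinsler F) (hinv : LeavesIndicatrixInvariant h F)
    (he : e ∈ charts n M) (v : Coord n) {x y : Coord n} (hx : x ∈ e.target) (hy : y ≠ 0) :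
    fderiv ℝ (Function.uncurry (localF F e)) (x, y) (v, parallelVelocity h e v x y) = 0 := by
  obtain ⟨Y, hY0, δ, hδ, hY⟩ := exists_parallel_along_line (h := h) he v hx y
  have hpos := localF_pos hF he hx hy
  -- The piece of line up to time `s` is reparametrised to `[0, 1]`, and the field is divided by
  -- `F(x, y)` so that it starts on the indicatrix. It then ends there too, and homogeneity undoes
  -- the scaling.
  have hconst : ∀ s ∈ Ico 0 δ, localF F e (x + s • v) (Y s) = localF F e x y := by
    intro s hs
    have hmem : ∀ t ∈ Icc (0 : ℝ) 1, t * s ∈ Ioo (-δ) δ := fun t ht =>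
      ⟨by nlinarith [mul_nonneg ht.1 hs.1],
        (mul_le_of_le_one_left hs.1 ht.2).trans_lt hs.2⟩
    have hpar := isParallelAlong_line (h := h) (c := (localF F e x y)⁻¹) he
      fun t ht => hY (t * s) (hmem t ht)
    have hsmooth : ContMDiffOn 𝓘(ℝ) (𝓡 n) ∞ (fun t : ℝ => e.symm (x + (t * s) • v))
        (Icc 0 1) :=
      (contMDiffOn_symm_of_mem_maximalAtlas he).comp
        ((show ContDiff ℝ ∞ fun t : ℝ => x + (t * s) • v by fun_prop).contMDiff.contMDiffOn)
        fun t ht => (hY _ (hmem t ht)).1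
    have himg : tangentOfCoord e (x + ((1 : ℝ) * s) • v) ((localF F e x y)⁻¹ • Y (1 * s)) ∈
        indicatrix F (e.symm (x + ((1 : ℝ) * s) • v)) := by
      rw [← hinv _ hsmooth]
      refine ⟨_, hpar, ?_, rfl⟩
      change localF F e (x + ((0 : ℝ) * s) • v) ((localF F e x y)⁻¹ • Y (0 * s)) = 1
      rw [zero_mul, hY0, zero_smul, add_zero, localF_smul hF _ _ (inv_pos.2 hpos),
        inv_mul_cancel₀ hpos.ne']
    have himg' : localF F e (x + ((1 : ℝ) * s) • v) ((localF F e x y)⁻¹ • Y (1 * s)) = 1 := himg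
    rw [one_mul, localF_smul hF _ _ (inv_pos.2 hpos)] at himg'
    field_simp at himg'
    exact himg'
  have h0 := (hY 0 ⟨by linarith, hδ⟩).2
  rw [zero_smul, add_zero, hY0] at h0
  have hcurve : HasDerivAt (fun s : ℝ => (x + s • v, Y s)) (v, parallelVelocity h e v x y) 0 := by
    refine HasDerivAt.prodMk ?_ h0
    simpa using ((hasDerivAt_id (0 : ℝ)).smul_const v).const_add x
  have hd : HasFDerivAt (Function.uncurry (localF F e))
      (fderiv ℝ (Function.uncurry (localF F e)) (x, y)) (x + (0 : ℝ) • v, Y 0) := by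
    rw [zero_smul, add_zero, hY0]
    exact (differentiableAt_uncurry isOpen_slit (contDiffOn_localF hF he)
      (mem_slit hx hy)).hasFDerivAt
  -- Constancy is known for `s ≥ 0` only; uniqueness of the one-sided derivative at `0` is enough.
  have h₁ := (hd.comp_hasDerivAt (0 : ℝ) hcurve).hasDerivWithinAt (s := Ici 0)
  have h₂ : HasDerivWithinAt (Function.uncurry (localF F e) ∘ fun s : ℝ => (x + s • v, Y s)) 0
      (Ici 0) 0 := by
    refine (hasDerivWithinAt_const (0 : ℝ) (Ici 0) (localF F e x y)).congr_of_eventuallyEq ?_ ?_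
    · filter_upwards [Ico_mem_nhdsGE hδ] with s hs using hconst s hs
    · exact hconst 0 ⟨le_rfl, hδ⟩
  exact (uniqueDiffOn_Ici (0 : ℝ) 0 self_mem_Ici).eq_deriv _ h₁ h₂

end ParallelTransport

/-! ### Christoffel symbols of a metric compatible with a symmetric connection -/

section ChristoffelAlgebra

variable {n : ℕ} {g ginv : Fin n → Fin n → ℝ} {P C G : Fin n → Fin n → Fin n → ℝ}
  {H : Fin n → Fin n → ℝ} {y : Fin n → ℝ} {f : ℝ}

/-- The Christoffel combination of a tensor `P_{kab} = Gᵐ_{bk} g_{am} + Gᵐ_{ak} g_{bm}` with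
symmetric coefficients `G`. -/
theorem christoffel_of_compatible
    (hinv : ∀ i m, ∑ s, ginv i s * g s m = if i = m then 1 else 0)
    (hG : ∀ i j k, G i j k = G i k j)
    (hP : ∀ k a b, P k a b = ∑ m, (G m b k * g a m + G m a k * g b m)) (i j k : Fin n) :
    1 / 2 * ∑ s, ginv i s * (P k s j - P s j k + P j s k) = G i j k := by
  -- Of the six terms, symmetry of `G` cancels four in pairs and makes the other two equal.
  have h₁ : ∀ s, P k s j - P s j k + P j s k = 2 * ∑ m, G m j k * g s m := by
    intro s
    rw [hP, hP, hP, ← Finset.sum_sub_distrib, ← Finset.sum_add_distrib, Finset.mul_sum]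
    refine Finset.sum_congr rfl fun m _ => ?_
    rw [hG m k j, hG m k s, hG m s j]
    ring
  calc 1 / 2 * ∑ s, ginv i s * (P k s j - P s j k + P j s k)
      = ∑ m, G m j k * ∑ s, ginv i s * g s m := by
        simp only [h₁, Finset.mul_sum]
        rw [Finset.sum_comm]
        exact Finset.sum_congr rfl fun m _ => Finset.sum_congr rfl fun s _ => by ring
    _ = G i j k := by simp [hinv]

/-- Here `C` plays the role of `∂g/∂y` and `P` that of `∂g/∂x`. The Christoffel combination is
linear in `P`: the compatible part returns `G`, and of the three `C`-terms two have a slot of `C`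
contracted with `y` and drop out. -/
theorem sum_christoffel_mul
    (hinv : ∀ i m, ∑ s, ginv i s * g s m = if i = m then 1 else 0)
    (hG : ∀ i j k, G i j k = G i k j) (hH : ∀ i k, H i k = ∑ j, G i j k * y j)
    (hC : ∀ a b c, C a b c = C b a c) (hC' : ∀ a b c, C a b c = C c b a)
    (hCy : ∀ a b, ∑ c, y c * C a b c = 0)
    (hP : ∀ k a b, P k a b =
      ∑ m, (G m b k * g a m + G m a k * g b m) + ∑ m, H m k * C a b m) (i j : Fin n) :
    ∑ k, 1 / 2 * (∑ s, ginv i s * (P k s j - P s j k + P j s k)) * y k =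
      H i j + 1 / 2 * ∑ s, ginv i s * ∑ m, (∑ k, H m k * y k) * C s j m := by
  set Q : Fin n → Fin n → Fin n → ℝ := fun k a b => ∑ m, (G m b k * g a m + G m a k * g b m)
    with hQ
  have hsplit : ∀ k, 1 / 2 * (∑ s, ginv i s * (P k s j - P s j k + P j s k)) =
      G i j k + 1 / 2 * ∑ s, ginv i s *
        (∑ m, H m k * C s j m - ∑ m, H m s * C j k m + ∑ m, H m j * C s k m) := by
    intro k
    rw [← christoffel_of_compatible (P := Q) hinv hG (fun _ _ _ => rfl) i j k, ← mul_add,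
      ← Finset.sum_add_distrib]
    refine congrArg _ (Finset.sum_congr rfl fun s _ => ?_)
    rw [hP, hP, hP]
    simp only [hQ]
    ring
  have hy : ∀ (c : Fin n → ℝ) a, ∑ k, y k * ∑ m, c m * C a k m = 0 := by
    intro c a
    simp only [Finset.mul_sum]
    rw [Finset.sum_comm]
    refine Finset.sum_eq_zero fun m _ => ?_
    rw [← mul_zero (c m), ← hCy m a, Finset.mul_sum]
    refine Finset.sum_congr rfl fun k _ => ?_
    rw [hC a k m, hC' k a m]
    ring
  have hGy : ∑ k, G i j k * y k = H i j := by
    rw [hH]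
    exact Finset.sum_congr rfl fun k _ => by rw [hG]
  simp only [hsplit, add_mul, Finset.sum_add_distrib, hGy]
  congr 1
  have hcomm : ∀ (c : Fin n → ℝ) (U V W : Fin n → Fin n → ℝ),
      ∑ k, 1 / 2 * (∑ s, c s * (U s k - V s k + W s k)) * y k =
        ∑ s, 1 / 2 * c s * (∑ k, y k * U s k - ∑ k, y k * V s k + ∑ k, y k * W s k) := by
    intro c U V W
    simp only [← Finset.sum_sub_distrib, ← Finset.sum_add_distrib, Finset.mul_sum, Finset.sum_mul]
    rw [Finset.sum_comm]
    exact Finset.sum_congr rfl fun s _ => Finset.sum_congr rfl fun k _ => by ring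
  calc ∑ k, 1 / 2 * (∑ s, ginv i s *
        (∑ m, H m k * C s j m - ∑ m, H m s * C j k m + ∑ m, H m j * C s k m)) * y k
      = ∑ s, 1 / 2 * ginv i s * (∑ k, y k * ∑ m, H m k * C s j m -
          ∑ k, y k * ∑ m, H m s * C j k m + ∑ k, y k * ∑ m, H m j * C s k m) := by
        exact hcomm _ (fun s k => ∑ m, H m k * C s j m) (fun s k => ∑ m, H m s * C j k m)
          (fun s k => ∑ m, H m j * C s k m)
    _ = 1 / 2 * ∑ s, ginv i s * ∑ m, (∑ k, H m k * y k) * C s j m := by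
        simp only [hy, sub_zero, add_zero]
        rw [Finset.mul_sum]
        refine Finset.sum_congr rfl fun s _ => ?_
        rw [mul_assoc]
        congr 2
        simp only [Finset.mul_sum, Finset.sum_mul]
        rw [Finset.sum_comm]
        exact Finset.sum_congr rfl fun m _ => Finset.sum_congr rfl fun k _ => by ring

/-- The non-linear connection of a Finsler metric compatible with a symmetric linear connection is
that of the linear connection. -/
theorem nonlinear_of_compatible (hf : f ≠ 0)
    (hinv : ∀ i m, ∑ s, ginv i s * g s m = if i = m then 1 else 0)
    (hG : ∀ i j k, G i j k = G i k j) (hH : ∀ i k, H i k = ∑ j, G i j k * y j)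
    (hC : ∀ a b c, C a b c = C b a c) (hC' : ∀ a b c, C a b c = C c b a)
    (hCy : ∀ a b, ∑ c, y c * C a b c = 0)
    (hP : ∀ k a b, P k a b =
      ∑ m, (G m b k * g a m + G m a k * g b m) + ∑ m, H m k * C a b m)
    {γ : Fin n → Fin n → Fin n → ℝ}
    (hγ : ∀ i j k, γ i j k = 1 / 2 * ∑ s, ginv i s * (P k s j - P s j k + P j s k))
    (i j : Fin n) :
    f * (∑ k, γ i j k * (y k / f) -
      ∑ k, ∑ r, ∑ s, (∑ l, ginv i l * (f / 2 * C l j k)) * γ k r s * (y r / f) * (y s / f)) =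
      H i j := by
  -- `K` is the spray `Gᵐ_{jk} yʲ yᵏ` of the linear connection.
  obtain ⟨K, hK⟩ : ∃ K : Fin n → ℝ, ∀ m, ∑ k, H m k * y k = K m := ⟨_, fun _ => rfl⟩
  have h₁ : ∀ i j, ∑ k, γ i j k * y k =
      H i j + 1 / 2 * ∑ s, ginv i s * ∑ m, K m * C s j m := by
    intro i j
    simp only [hγ, ← hK]
    exact sum_christoffel_mul hinv hG hH hC hC' hCy hP i j
  -- A second contraction with `y` kills the remaining `C`-term, so `γ` and `G` have the same spray.
  have h₂ : ∀ k, ∑ r, y r * ∑ s, γ k r s * y s = K k := by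
    intro k
    have h0 : ∑ r, y r * (1 / 2 * ∑ s, ginv k s * ∑ m, K m * C s r m) = 0 := by
      simp only [Finset.mul_sum]
      rw [Finset.sum_comm]
      refine Finset.sum_eq_zero fun s _ => ?_
      rw [Finset.sum_comm]
      refine Finset.sum_eq_zero fun m _ => ?_
      rw [← mul_zero (1 / 2 * ginv k s * K m), ← hCy m s, Finset.mul_sum]
      refine Finset.sum_congr rfl fun r _ => ?_
      rw [hC s r m, hC' r s m, hC m s r]
      ring
    simp only [h₁, mul_add, Finset.sum_add_distrib, h0, add_zero]
    rw [← hK]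
    exact Finset.sum_congr rfl fun r _ => mul_comm _ _
  have h₃ : f * ∑ k, γ i j k * (y k / f) = ∑ k, γ i j k * y k := by
    rw [Finset.mul_sum]
    exact Finset.sum_congr rfl fun k _ => by field_simp
  have h₄ : f * ∑ k, ∑ r, ∑ s,
      (∑ l, ginv i l * (f / 2 * C l j k)) * γ k r s * (y r / f) * (y s / f) =
      ∑ k, (∑ l, 1 / 2 * (ginv i l * C l j k)) * ∑ r, y r * ∑ s, γ k r s * y s := by
    have hl : ∀ k, ∑ l, ginv i l * (f / 2 * C l j k) =
        f * ∑ l, 1 / 2 * (ginv i l * C l j k) := by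
      intro k
      rw [Finset.mul_sum]
      exact Finset.sum_congr rfl fun l _ => by ring
    simp only [hl]
    rw [Finset.mul_sum]
    refine Finset.sum_congr rfl fun k _ => ?_
    generalize ∑ l, 1 / 2 * (ginv i l * C l j k) = B
    simp only [Finset.mul_sum]
    refine Finset.sum_congr rfl fun r _ => Finset.sum_congr rfl fun s _ => ?_
    field_simp
  rw [mul_sub, h₃, h₄, h₁]
  simp only [h₂]
  -- The surviving `C`-term of `h₁` and the Cartan correction are the same double sum.
  rw [add_sub_assoc, sub_eq_zero.2, add_zero]
  simp only [Finset.sum_mul, Finset.mul_sum]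
  rw [Finset.sum_comm]
  exact Finset.sum_congr rfl fun m _ => Finset.sum_congr rfl fun s _ => by ring

end ChristoffelAlgebra

/-! ### The Chern and Berwald connections -/

section BerwaldConnection

variable {n : ℕ} {M : Type*} [TopologicalSpace M] [ChartedSpace (Coord n) M]
  [IsManifold (𝓡 n) ∞ M] {F : TangentBundle (𝓡 n) M → ℝ} {h : RiemannianMetric n M}
  {e : OpenPartialHomeomorph M (Coord n)}

/-- `∂F²/∂xᵏ = ʰΓⁱ_{jk} yʲ ∂F²/∂yⁱ`. -/
theorem dX_sqF (hF : IsFinsler F) (hinv : LeavesIndicatrixInvariant h F) (he : e ∈ charts n M)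
    (k : Fin n) {x y : Coord n} (hp : (x, y) ∈ slit e) :
    dX k (sqF F e) x y =
      ∑ i, (∑ j, leviCivitaCoeff h e i j k x * y j) * dY i (sqF F e) x y := by
  have hd := differentiableAt_uncurry isOpen_slit (contDiffOn_localF hF he) hp
  have hd' := differentiableAt_uncurry isOpen_slit (contDiffOn_sqF hF he) hp
  set w := parallelVelocity h e (EuclideanSpace.single k 1) x y with hw
  have h₀ : fderiv ℝ (Function.uncurry (sqF F e)) (x, y) (EuclideanSpace.single k 1, w) = 0 := by
    have h₁ : Function.uncurry (sqF F e) = fun p => Function.uncurry (localF F e) p ^ 2 := rfl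
    rw [h₁, (hd.hasFDerivAt.pow 2).fderiv]
    simp [fderiv_localF_horizontal hF hinv he (EuclideanSpace.single k 1) hp.1 hp.2, hw]
  have h₂ : fderiv ℝ (Function.uncurry (sqF F e)) (x, y) (0, w) =
      ∑ i, w i * dY i (sqF F e) x y := by
    have h₃ : ((0 : Coord n), w) = ∑ i, w i • ((0 : Coord n), EuclideanSpace.single i (1 : ℝ)) := by
      conv_lhs => rw [← (EuclideanSpace.basisFun (Fin n) ℝ).sum_repr w]
      simp [Prod.ext_iff, Prod.fst_sum, Prod.snd_sum]
    rw [h₃, map_sum]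
    exact Finset.sum_congr rfl fun i _ => by rw [map_smul, dY_eq_fderiv i hd', smul_eq_mul]
  -- The horizontal vector splits into `∂/∂xᵏ` and the vertical vector `w`, whose components are
  -- `-ʰΓⁱ_{jk} yʲ`.
  have h₄ : ((EuclideanSpace.single k 1 : Coord n), w) =
      (EuclideanSpace.single k 1, 0) + (0, w) := by simp
  rw [h₄, map_add, h₂, ← dX_eq_fderiv k hd'] at h₀
  rw [eq_neg_of_add_eq_zero_left h₀, ← Finset.sum_neg_distrib]
  refine Finset.sum_congr rfl fun i _ => ?_
  rw [← neg_mul]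
  congr 1
  simp [hw, parallelVelocity]

/-- The horizontal compatibility of the fundamental tensor with `∇ʰ`:
`∂g_{ab}/∂xᵏ = ʰΓᵐ_{bk} g_{am} + ʰΓᵐ_{ak} g_{bm} + ʰΓᵐ_{jk} yʲ ∂g_{ab}/∂yᵐ`. -/
theorem dX_fundTensor (hF : IsFinsler F) (hinv : LeavesIndicatrixInvariant h F)
    (he : e ∈ charts n M) (k a b : Fin n) {x y : Coord n} (hp : (x, y) ∈ slit e) :
    dX k (fundTensor F e a b) x y =
      ∑ m, (leviCivitaCoeff h e m b k x * fundTensor F e a m x y +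
        leviCivitaCoeff h e m a k x * fundTensor F e b m x y) +
      ∑ m, (∑ j, leviCivitaCoeff h e m j k x * y j) * dY m (fundTensor F e a b) x y := by
  have hs := contDiffOn_sqF hF he
  have hs₁ := fun i => contDiffOn_dY i isOpen_slit hs
  have hs₂ := fun i j => contDiffOn_dY i isOpen_slit (hs₁ j)
  have hdiff := fun {f : Coord n → Coord n → ℝ}
    (hf : ContDiffOn ℝ ∞ (Function.uncurry f) (slit e)) {x y : Coord n}
    (hp : (x, y) ∈ slit e) => differentiableAt_snd isOpen_slit hf hp
  -- `∂/∂yᵇ` of `dX_sqF`. It is proved on the whole slit domain because it is differentiated once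
  -- more, by `∂/∂yᵃ`, in `h₂`.
  have h₁ : ∀ x y, (x, y) ∈ slit e → dX k (dY b (sqF F e)) x y =
      ∑ m, leviCivitaCoeff h e m b k x * dY m (sqF F e) x y +
      ∑ m, (∑ j, leviCivitaCoeff h e m j k x * y j) * dY b (dY m (sqF F e)) x y := by
    intro x y hp
    rw [dX_dY_comm k b isOpen_slit hs hp,
      dY_congr b isOpen_slit (fun x y hp => dX_sqF hF hinv he k hp) hp,
      dY_sum_linear_mul b (c := fun m j x => leviCivitaCoeff h e m j k x)
        (f := fun m => dY m (sqF F e)) fun m => hdiff (hs₁ m) hp, Finset.sum_add_distrib]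
  have hlin : ∀ m, DifferentiableAt ℝ
      (fun z : Coord n => ∑ j, leviCivitaCoeff h e m j k x * z j) y := fun m => by fun_prop
  have h₂ : dX k (dY a (dY b (sqF F e))) x y =
      ∑ m, leviCivitaCoeff h e m b k x * dY a (dY m (sqF F e)) x y +
      ∑ m, (leviCivitaCoeff h e m a k x * dY b (dY m (sqF F e)) x y +
        (∑ j, leviCivitaCoeff h e m j k x * y j) * dY a (dY b (dY m (sqF F e))) x y) := by
    rw [dX_dY_comm k a isOpen_slit (hs₁ b) hp, dY_congr a isOpen_slit h₁ hp, dY_add,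
      dY_sum_mul a (c := fun m x => leviCivitaCoeff h e m b k x)
        (f := fun m => dY m (sqF F e)) fun m => hdiff (hs₁ m) hp,
      dY_sum_linear_mul a (c := fun m j x => leviCivitaCoeff h e m j k x)
        (f := fun m => dY b (dY m (sqF F e))) fun m => hdiff (hs₂ b m) hp]
    · exact DifferentiableAt.fun_sum fun m _ => (hdiff (hs₁ m) hp).const_mul _
    · exact DifferentiableAt.fun_sum fun m _ => (hlin m).mul (hdiff (hs₂ b m) hp)
  have h₃ : dX k (fundTensor F e a b) x y = 1 / 2 * dX k (dY a (dY b (sqF F e))) x y :=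
    dX_const_mul k (1 / 2) isOpen_slit (hs₂ a b) hp
  have h₄ : ∀ m, dY m (fundTensor F e a b) x y = 1 / 2 * dY a (dY b (dY m (sqF F e))) x y := by
    intro m
    rw [← dY_const_mul a (1 / 2) isOpen_slit (hs₂ b m) hp]
    change _ = dY a (fundTensor F e b m) x y
    rw [dY_fundTensor_symm hF he hp b m a, dY_fundTensor_comm hF he hp m b a]
  have h₅ : ∀ a m, fundTensor F e a m x y = 1 / 2 * dY a (dY m (sqF F e)) x y := fun _ _ => rfl
  rw [h₃, h₂]
  simp only [h₄, h₅]
  rw [← Finset.sum_add_distrib, ← Finset.sum_add_distrib, Finset.mul_sum]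
  exact Finset.sum_congr rfl fun m _ => by ring

theorem nonlinearCoeff_eq (hF : IsFinsler F) (hinv : LeavesIndicatrixInvariant h F)
    (he : e ∈ charts n M) {x y : Coord n} (hx : x ∈ e.target) (hy : y ≠ 0) (i j : Fin n) :
    nonlinearCoeff F e i j x y = ∑ l, leviCivitaCoeff h e i l j x * y l := by
  have hp := mem_slit hx hy
  exact nonlinear_of_compatible (g := fun a b => fundTensor F e a b x y)
    (ginv := fun a b => fundInv F e a b x y) (G := fun a b c => leviCivitaCoeff h e a b c x)
    (P := fun k a b => dX k (fundTensor F e a b) x y)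
    (C := fun a b c => dY c (fundTensor F e a b) x y)
    (H := fun i k => ∑ l, leviCivitaCoeff h e i l k x * y l) (y := y)
    (γ := fun i j k => formalChristoffel F e i j k x y)
    (localF_pos hF he hx hy).ne' (sum_fundInv_mul_fundTensor hF he hx hy)
    (fun _ _ _ => leviCivitaCoeff_symm _ _ _ _) (fun _ _ => rfl)
    (fun a b c => dY_fundTensor_symm hF he hp a b c)
    (fun a b c => dY_fundTensor_comm hF he hp a b c)
    (fun a b => sum_mul_dY_fundTensor hF he hx hy a b)
    (fun k a b => dX_fundTensor hF hinv he k a b hp) (fun _ _ _ => rfl) i j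

/-- The Chern connection has the same coefficients as `∇ʰ`. -/
theorem chernCoeff_eq (hF : IsFinsler F) (hinv : LeavesIndicatrixInvariant h F)
    (he : e ∈ charts n M) {x y : Coord n} (hx : x ∈ e.target) (hy : y ≠ 0) (i j k : Fin n) :
    chernCoeff F e i j k x y = leviCivitaCoeff h e i j k x := by
  refine christoffel_of_compatible (g := fun a b => fundTensor F e a b x y)
    (ginv := fun a b => fundInv F e a b x y) (G := fun a b c => leviCivitaCoeff h e a b c x)
    (P := fun k a b => deltaX F e k (fundTensor F e a b) x y)
    (sum_fundInv_mul_fundTensor hF he hx hy)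
    (fun _ _ _ => leviCivitaCoeff_symm _ _ _ _) (fun k a b => ?_) i j k
  simp only [deltaX]
  rw [dX_fundTensor hF hinv he k a b (mem_slit hx hy)]
  -- Passing from `∂/∂xᵏ` to `δ/δxᵏ` subtracts precisely the `∂g/∂y` term, leaving pure metric
  -- compatibility.
  simp only [nonlinearCoeff_eq hF hinv he hx hy, add_sub_cancel_right]

/-- The Chern coefficients equal functions of `x` on the open slit domain, so their `y`-derivatives,
and with them `P`, vanish. -/
theorem landsberg_eq_zero (hF : IsFinsler F) (hinv : LeavesIndicatrixInvariant h F)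
    (he : e ∈ charts n M) {x y : Coord n} (hx : x ∈ e.target) (hy : y ≠ 0) (i k l : Fin n) :
    landsberg F e i k l x y = 0 := by
  have h₀ : ∀ j, dY l (chernCoeff F e i j k) x y = 0 := by
    intro j
    rw [dY_congr (g := fun x _ => leviCivitaCoeff h e i j k x) l isOpen_slit
      (fun x y hp => chernCoeff_eq hF hinv he hp.1 hp.2 i j k) (mem_slit hx hy)]
    simp [dY]
  simp [landsberg, hvCurvature, h₀]

theorem berwaldCoeff_eq (hF : IsFinsler F) (hinv : LeavesIndicatrixInvariant h F)
    (he : e ∈ charts n M) {x y : Coord n} (hx : x ∈ e.target) (hy : y ≠ 0) (i j k : Fin n) :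
    berwaldCoeff F e i j k x y = leviCivitaCoeff h e i j k x := by
  rw [berwaldCoeff, chernCoeff_eq hF hinv he hx hy, landsberg_eq_zero hF hinv he hx hy, add_zero]

end BerwaldConnection

end FinslerGeometry

end

theorem proposition5p3p7 {n : ℕ} {M : Type*} [TopologicalSpace M]
    [ChartedSpace (EuclideanSpace ℝ (Fin n)) M] [IsManifold (𝓡 n) ∞ M]
    (F : TangentBundle (𝓡 n) M → ℝ) (hF : FinslerGeometry.IsFinsler F)
    (h : FinslerGeometry.RiemannianMetric n M)
    (hinv : FinslerGeometry.LeavesIndicatrixInvariant h F) :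
    (∀ e ∈ FinslerGeometry.charts n M, ∀ x ∈ e.target,
      ∀ y : EuclideanSpace ℝ (Fin n), y ≠ 0 → ∀ (i j : Fin n)
        (ξ : EuclideanSpace ℝ (Fin n) × EuclideanSpace ℝ (Fin n)),
        FinslerGeometry.berwaldForm F e i j x y ξ =
          FinslerGeometry.pullbackForm h e i j x y ξ) ∧
    FinslerGeometry.IsBerwald F := by
  refine ⟨fun e he x hx y hy i j ξ => ?_, fun e he x hx y y' hy hy' i j k => ?_⟩
  · exact Finset.sum_congr rfl fun k _ => by
      rw [FinslerGeometry.berwaldCoeff_eq hF hinv he hx hy]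
  · rw [FinslerGeometry.chernCoeff_eq hF hinv he hx hy,
      FinslerGeometry.chernCoeff_eq hF hinv he hx hy']
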